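/- A \emph{model of set theory} is a first-order structure $\langle M,\in^M\rangle$ satisfying (at least) the axioms of Kripke--Platek set theory $\mathrm{KP}$: extensionality, the existence of the empty set, pairing, union, the foundation scheme for all first-order formulas, $\Delta_0$-separation and $\Delta_0$-collection (formulas may contain parameters; the axiom of infinity is not assumed). The constructible hierarchy is given by $L_0=\emptyset$, $L_{\alpha+1}=\mathrm{Def}(L_\alpha)$, the set of all subsets of $L_\alpha$ that are first-order definable with parameters over $\langle L_\alpha,\in\rangle$, and $L_\alpha=\bigcup_{\beta<\alpha}L_\beta$ for limit ordinals $\alpha$. A submodel of $\langle N,\in\rangle$ is a subset of $N$ with the restriction of $\in$ to it. Let $M$ be a countable transitive set such that $\langle M,\in\rangle$ is a model of set theory, and let $\lambda=\mathrm{Ord}^M$ be the set of ordinals that are elements of $M$ (which is itself an ordinal). Then $\langle M,\in\rangle$ is isomorphic to a submodel of $\langle L_{\lambda+\lambda},\in\rangle$. -/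

import Mathlib

universe u v

namespace KPSet

open FirstOrder FirstOrder.Language

/-! ### The language of set theory -/

/-- The relation symbols of the language of set theory: one binary symbol. -/
inductive MemRel : ℕ → Type
  | mem : MemRel 2

/-- The first-order language of set theory, whose only non-logical symbol is the membership
relation. -/
def LSet : FirstOrder.Language.{0, 0} :=
  ⟨fun _ => Empty, MemRel⟩

/-- The membership symbol. -/
abbrev memSymb : LSet.Relations 2 := MemRel.mem

/-- A set `X`, regarded as the structure `⟨X, ∈⟩` on its elements. -/
instance memStructure (X : ZFSet.{u}) : LSet.Structure X where
  funMap := fun f => Empty.elim f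
  RelMap := fun {_} r => match r with
    | MemRel.mem => fun x => (x 0 : ZFSet.{u}) ∈ (x 1 : ZFSet.{u})

/-- The interpretation of membership in a structure for the language of set theory. -/
def E {A : Type v} [LSet.Structure A] (a b : A) : Prop :=
  Structure.RelMap memSymb ![a, b]

theorem E_iff {X : ZFSet.{u}} (a b : X) : E a b ↔ (a : ZFSet.{u}) ∈ (b : ZFSet.{u}) := Iff.rfl

/-- `Δ₀`-formulas: built from atomic formulas by propositional connectives (`⊥` and `→`) and
bounded quantification `∀ x ∈ y, φ`, where the bound `y` is a variable different from `x`. Bounded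
existential quantification is obtained as `¬ ∀ x ∈ y, ¬ φ`. -/
inductive IsDelta0 {α : Type} : ∀ {n : ℕ}, LSet.BoundedFormula α n → Prop
  | falsum {n : ℕ} : IsDelta0 (BoundedFormula.falsum : LSet.BoundedFormula α n)
  | equal {n : ℕ} (s t : LSet.Term (α ⊕ Fin n)) : IsDelta0 (Term.bdEqual s t)
  | mem {n : ℕ} (s t : LSet.Term (α ⊕ Fin n)) : IsDelta0 (memSymb.boundedFormula₂ s t)
  | imp {n : ℕ} {φ ψ : LSet.BoundedFormula α n} :
      IsDelta0 φ → IsDelta0 ψ → IsDelta0 (φ.imp ψ)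
  | ball {n : ℕ} (y : α ⊕ Fin n) {φ : LSet.BoundedFormula α (n + 1)} :
      IsDelta0 φ →
      IsDelta0 (BoundedFormula.all
        ((memSymb.boundedFormula₂ (Term.var (Sum.inr (Fin.last n)))
          (Term.var (Sum.map id Fin.castSucc y))).imp φ))

/-- The structure `A` satisfies the axioms of Kripke-Platek set theory `KP` (the axiom of infinity
is not among them). In the three schemes, formulas have their free variables among `v₀, v₁, …`; the
variable `v₀` (and `v₁` for collection) plays the distinguished role, and the other variables
are parameters. -/
structure ModelsKP (A : Type v) [LSet.Structure A] : Prop where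
  empty : ∃ a : A, ∀ x : A, ¬ E x a
  extensionality : ∀ a b : A, (∀ x : A, E x a ↔ E x b) → a = b
  pairing : ∀ a b : A, ∃ c : A, ∀ x : A, E x c ↔ x = a ∨ x = b
  union : ∀ a : A, ∃ b : A, ∀ x : A, E x b ↔ ∃ y : A, E y a ∧ E x y
  foundation : ∀ (φ : LSet.Formula ℕ) (p : ℕ → A),
    (∃ x : A, φ.Realize (Function.update p 0 x)) →
    ∃ x : A, φ.Realize (Function.update p 0 x) ∧
      ∀ y : A, E y x → ¬ φ.Realize (Function.update p 0 y)
  separation : ∀ (φ : LSet.Formula ℕ), IsDelta0 φ → ∀ (p : ℕ → A) (a : A),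
    ∃ b : A, ∀ x : A, E x b ↔ E x a ∧ φ.Realize (Function.update p 0 x)
  collection : ∀ (φ : LSet.Formula ℕ), IsDelta0 φ → ∀ (p : ℕ → A) (a : A),
    (∀ x : A, E x a → ∃ y : A, φ.Realize (Function.update (Function.update p 0 x) 1 y)) →
    ∃ b : A, ∀ x : A, E x a →
      ∃ y : A, E y b ∧ φ.Realize (Function.update (Function.update p 0 x) 1 y)

/-! ### The constructible hierarchy -/

/-- `Def(X)`: the set of all subsets of `X` that are first-order definable with parameters over the
structure `⟨X, ∈⟩`. -/
noncomputable def defPowerset (X : ZFSet.{u}) : ZFSet.{u} :=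
  ZFSet.sep
    (fun s => (Set.univ : Set X).Definable₁ LSet {x : X | (x : ZFSet.{u}) ∈ s})
    X.powerset

/-- The constructible hierarchy: `L_0 = ∅`, `L_{α+1} = Def(L_α)`, and `L_α = ⋃_{β<α} L_β` for limit
ordinals `α`. -/
noncomputable def constructible (α : Ordinal.{u}) : ZFSet.{u} :=
  Ordinal.limitRecOn α ∅ (fun _ X => defPowerset X)
    (fun α _ f => ZFSet.iUnion (fun β : Set.Iio α => f β.1 β.2))

theorem constructible_zero : constructible.{u} 0 = ∅ := by
  simp [constructible]

theorem constructible_add_one (α : Ordinal.{u}) :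
    constructible (α + 1) = defPowerset (constructible α) := by
  simp [constructible]

theorem constructible_limit {α : Ordinal.{u}} (h : Order.IsSuccLimit α) :
    constructible α = ZFSet.iUnion (fun β : Set.Iio α => constructible β.1) := by
  simp only [constructible]
  rw [Ordinal.limitRecOn_limit _ _ _ _ h]

/-- `Ord^M`: the set of ordinals that are elements of the transitive set `M`. -/
def ordinalsOf (M : ZFSet.{u}) : ZFSet.{u} := ZFSet.sep ZFSet.IsOrdinal M

end KPSet

/-! Two facts combine: every element of `M` has rank below `λ`, and a countable transitive set with
all ranks below a limit `λ` embeds into `L_{ω+λ}`. A limit is at least `ω`, so `ω + λ ≤ λ + λ`.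

For the ranks (`ModelsKP.rank_lt`) it suffices to find in `M` an ordinal bounding each rank, not the
rank function itself. Witnesses are sets of pairs `{u, α}` whose bounds decrease along membership;
this is `Δ₀`, so collection glues witnesses for the elements of `x` into one for `x`.

For the embedding (`exists_embedding_constructible`), the obvious recursion `f y = {f x | x ∈ y}`
need not give definable sets. Instead, enumerate `M` and give each `x` a hereditarily finite marker
recording which earlier-enumerated sets contain `x`; a second finite set attached to `y` lists the
markers of its earlier-enumerated elements. Whichever of `x`, `y` comes later thus knows whether `x
∈ y`. The set `f y` is cut out of one level of `L` by a fixed formula whose parameters are `L_ω` and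
the two finite sets of `y`. As `f x` meets `L_ω` exactly in the marker of `x`, the formula can
decide whether `f x` belongs to `f y`. -/

namespace KPSet

open FirstOrder FirstOrder.Language

/-! ### `Δ₀`-formulas over transitive sets -/

section Formulas

variable {n : ℕ}

/-- The formula `x ∈ y`. -/
abbrev memF (x y : ℕ ⊕ Fin n) : LSet.BoundedFormula ℕ n :=
  memSymb.boundedFormula₂ (Term.var x) (Term.var y)

/-- The formula `x = y`. -/
abbrev eqF (x y : ℕ ⊕ Fin n) : LSet.BoundedFormula ℕ n :=
  Term.bdEqual (Term.var x) (Term.var y)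

/-- A variable, in the scope of one more quantifier. -/
abbrev liftVar (x : ℕ ⊕ Fin n) : ℕ ⊕ Fin (n + 1) := Sum.map id Fin.castSucc x

/-- The variable bound by the innermost quantifier. -/
abbrev newVar : ℕ ⊕ Fin (n + 1) := Sum.inr (Fin.last n)

/-- Negation. -/
def notF (φ : LSet.BoundedFormula ℕ n) : LSet.BoundedFormula ℕ n := φ.imp BoundedFormula.falsum

/-- Conjunction. -/
def andF (φ ψ : LSet.BoundedFormula ℕ n) : LSet.BoundedFormula ℕ n := notF (φ.imp (notF ψ))

/-- Disjunction. -/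
def orF (φ ψ : LSet.BoundedFormula ℕ n) : LSet.BoundedFormula ℕ n := (notF φ).imp ψ

/-- Bounded universal quantification. -/
def ballF (y : ℕ ⊕ Fin n) (φ : LSet.BoundedFormula ℕ (n + 1)) : LSet.BoundedFormula ℕ n :=
  BoundedFormula.all ((memF newVar (liftVar y)).imp φ)

/-- Bounded existential quantification. -/
def bexF (y : ℕ ⊕ Fin n) (φ : LSet.BoundedFormula ℕ (n + 1)) : LSet.BoundedFormula ℕ n :=
  notF (ballF y (notF φ))

theorem IsDelta0.notF {φ : LSet.BoundedFormula ℕ n} (h : IsDelta0 φ) : IsDelta0 (notF φ) :=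
  h.imp .falsum

theorem IsDelta0.andF {φ ψ : LSet.BoundedFormula ℕ n} (h : IsDelta0 φ) (h' : IsDelta0 ψ) :
    IsDelta0 (andF φ ψ) :=
  (h.imp h'.notF).notF

theorem IsDelta0.orF {φ ψ : LSet.BoundedFormula ℕ n} (h : IsDelta0 φ) (h' : IsDelta0 ψ) :
    IsDelta0 (orF φ ψ) :=
  h.notF.imp h'

theorem IsDelta0.ballF (y : ℕ ⊕ Fin n) {φ : LSet.BoundedFormula ℕ (n + 1)} (h : IsDelta0 φ) :
    IsDelta0 (ballF y φ) :=
  .ball y h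

theorem IsDelta0.bexF (y : ℕ ⊕ Fin n) {φ : LSet.BoundedFormula ℕ (n + 1)} (h : IsDelta0 φ) :
    IsDelta0 (bexF y φ) :=
  (h.notF.ballF y).notF

variable {M : ZFSet.{u}} {v : ℕ → M} {xs : Fin n → M}

@[simp] theorem realize_memF (x y : ℕ ⊕ Fin n) : (memF x y).Realize v xs ↔
    (Sum.elim v xs x).1 ∈ (Sum.elim v xs y).1 := by
  simp only [memF, BoundedFormula.realize_rel₂]
  exact Iff.rfl

@[simp] theorem realize_eqF (x y : ℕ ⊕ Fin n) : (eqF x y).Realize v xs ↔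
    (Sum.elim v xs x).1 = (Sum.elim v xs y).1 := by
  simp only [eqF, BoundedFormula.realize_bdEqual, Term.realize_var]
  exact Subtype.ext_iff

@[simp] theorem realize_notF (φ : LSet.BoundedFormula ℕ n) :
    (notF φ).Realize v xs ↔ ¬ φ.Realize v xs := Iff.rfl

@[simp] theorem realize_andF (φ ψ : LSet.BoundedFormula ℕ n) :
    (andF φ ψ).Realize v xs ↔ φ.Realize v xs ∧ ψ.Realize v xs := by
  simp [andF]

@[simp] theorem realize_orF (φ ψ : LSet.BoundedFormula ℕ n) :
    (orF φ ψ).Realize v xs ↔ φ.Realize v xs ∨ ψ.Realize v xs := by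
  simp [orF, or_iff_not_imp_left]

@[simp] theorem elim_snoc_liftVar (x : ℕ ⊕ Fin n) (a : M) :
    Sum.elim v (Fin.snoc xs a : Fin (n + 1) → M) (liftVar x) = Sum.elim v xs x := by
  cases x <;> simp

@[simp] theorem realize_ballF (hM : M.IsTransitive) (y : ℕ ⊕ Fin n)
    (φ : LSet.BoundedFormula ℕ (n + 1)) :
    (ballF y φ).Realize v xs ↔ ∀ (a : ZFSet.{u}) (h : a ∈ (Sum.elim v xs y).1),
      φ.Realize v (Fin.snoc xs ⟨a, hM.mem_trans h (Sum.elim v xs y).2⟩) := by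
  simp only [ballF, BoundedFormula.realize_all, BoundedFormula.realize_imp, realize_memF,
    elim_snoc_liftVar, Sum.elim_inr, Fin.snoc_last]
  exact ⟨fun h a ha => h ⟨a, _⟩ ha, fun h a ha => h a.1 ha⟩

@[simp] theorem realize_bexF (hM : M.IsTransitive) (y : ℕ ⊕ Fin n)
    (φ : LSet.BoundedFormula ℕ (n + 1)) :
    (bexF y φ).Realize v xs ↔ ∃ (a : ZFSet.{u}) (h : a ∈ (Sum.elim v xs y).1),
      φ.Realize v (Fin.snoc xs ⟨a, hM.mem_trans h (Sum.elim v xs y).2⟩) := by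
  simp [bexF, hM]

/-- The formula `x = {y, z}`. -/
def pairF (x y z : ℕ ⊕ Fin n) : LSet.BoundedFormula ℕ n :=
  andF (memF y x) (andF (memF z x)
    (ballF x (orF (eqF newVar (liftVar y)) (eqF newVar (liftVar z)))))

theorem isDelta0_pairF (x y z : ℕ ⊕ Fin n) : IsDelta0 (pairF x y z) :=
  .andF (.mem _ _) (.andF (.mem _ _) (.ballF _ (.orF (.equal _ _) (.equal _ _))))

@[simp] theorem realize_pairF (hM : M.IsTransitive) (x y z : ℕ ⊕ Fin n) :
    (pairF x y z).Realize v xs ↔ (Sum.elim v xs x).1 =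
      {(Sum.elim v xs y).1, (Sum.elim v xs z).1} := by
  simp only [pairF, realize_andF, realize_memF, realize_ballF hM, realize_orF, realize_eqF,
    elim_snoc_liftVar, Sum.elim_inr, Fin.snoc_last]
  constructor
  · rintro ⟨hy, hz, h⟩
    ext a
    rw [ZFSet.mem_pair]
    refine ⟨h a, ?_⟩
    rintro (rfl | rfl)
    exacts [hy, hz]
  · intro h
    simp [h]

/-- The formula `x is an ordinal`. -/
def ordF (x : ℕ ⊕ Fin n) : LSet.BoundedFormula ℕ n :=
  ballF x (ballF newVar (andF (memF newVar (liftVar (liftVar x)))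
    (ballF newVar (memF newVar (liftVar (liftVar newVar))))))

theorem isDelta0_ordF (x : ℕ ⊕ Fin n) : IsDelta0 (ordF x) :=
  .ballF _ (.ballF _ (.andF (.mem _ _) (.ballF _ (.mem _ _))))

@[simp] theorem realize_ordF (hM : M.IsTransitive) (x : ℕ ⊕ Fin n) :
    (ordF x).Realize v xs ↔ (Sum.elim v xs x).1.IsOrdinal := by
  simp only [ordF, realize_andF, realize_memF, realize_ballF hM,
    elim_snoc_liftVar, Sum.elim_inr, Fin.snoc_last]
  constructor
  · intro h
    exact ⟨fun y hy z hz => (h y hy z hz).1, fun hy hz hw => (h _ hw _ hz).2 _ hy⟩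
  · intro h y hy z hz
    exact ⟨h.mem_trans hz hy, fun a ha => h.mem_trans' ha hz hy⟩

end Formulas

/-! ### Ranks in transitive models of `KP` -/

/-- The relation coded by `w`: the unordered pair `{u, α}` belongs to `w`, where `α ∉ u` tells
which of the two components is the bound when both are ordinals. -/
def CodedBound (w u α : ZFSet.{u}) : Prop := ({u, α} : ZFSet.{u}) ∈ w ∧ α ∉ u

/-- The bounds assigned by `w` decrease along membership, so that they bound the ranks. -/
def IsBounding (w : ZFSet.{u}) : Prop :=
  ∀ p ∈ w, ∀ u ∈ p, ∀ α ∈ p, α.IsOrdinal → p = {u, α} → α ∉ u →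
    ∀ v ∈ u, ∃ β ∈ α, CodedBound w v β

theorem CodedBound.mono {w w' u α : ZFSet.{u}} (h : CodedBound w u α) (hw : w ⊆ w') :
    CodedBound w' u α := ⟨hw h.1, h.2⟩

theorem IsBounding.exists_mem {w u α v : ZFSet.{u}} (hw : IsBounding w) (h : CodedBound w u α)
    (hα : α.IsOrdinal) (hv : v ∈ u) : ∃ β ∈ α, CodedBound w v β :=
  hw _ h.1 u (by simp) α (by simp) hα rfl h.2 v hv

theorem IsBounding.rank_le {w u α : ZFSet.{u}} (hw : IsBounding w) (h : CodedBound w u α)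
    (hα : α.IsOrdinal) : u.rank ≤ α.rank := by
  induction u using ZFSet.inductionOn generalizing α with
  | _ u ih =>
    rw [ZFSet.rank_le_iff]
    intro v hv
    obtain ⟨β, hβ, hvβ⟩ := hw.exists_mem h hα hv
    exact (ih v hv hvβ (hα.mem hβ)).trans_lt (ZFSet.rank_lt_of_mem hβ)

theorem IsBounding.sUnion {b : ZFSet.{u}} (h : ∀ w ∈ b, IsBounding w) :
    IsBounding (ZFSet.sUnion b) := by
  intro p hp u hu α hα hord hpair hn v hv
  obtain ⟨w, hw, hpw⟩ := ZFSet.mem_sUnion.1 hp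
  obtain ⟨β, hβ, hc⟩ := h w hw p hpw u hu α hα hord hpair hn v hv
  exact ⟨β, hβ, hc.mono fun _ hz => ZFSet.mem_sUnion_of_mem hz hw⟩

/-- The formula `v_k` is bounding. -/
def boundingF (k : ℕ) : LSet.Formula ℕ :=
  -- The bound variables 0 to 5 are `p`, `u`, `α`, `v`, `β` and the pair `q = {v, β}` in `w`.
  ballF (.inl k) (ballF (.inr 0) (ballF (.inr 0) ((ordF (.inr 2)).imp
    ((pairF (.inr 0) (.inr 1) (.inr 2)).imp ((notF (memF (.inr 2) (.inr 1))).imp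
      (ballF (.inr 1) (bexF (.inr 2) (bexF (.inl k)
        (andF (pairF (.inr 5) (.inr 3) (.inr 4)) (notF (memF (.inr 4) (.inr 3))))))))))))

theorem isDelta0_boundingF (k : ℕ) : IsDelta0 (boundingF k) :=
  .ballF _ (.ballF _ (.ballF _ ((isDelta0_ordF _).imp ((isDelta0_pairF _ _ _).imp
    (.imp (.notF (.mem _ _)) (.ballF _ (.bexF _ (.bexF _
      (.andF (isDelta0_pairF _ _ _) (.notF (.mem _ _)))))))))))

theorem realize_boundingF {M : ZFSet.{u}} (hM : M.IsTransitive) (k : ℕ) (v : ℕ → M) :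
    (boundingF k).Realize v ↔ IsBounding (v k) := by
  simp only [boundingF, Formula.Realize, realize_ballF hM, realize_bexF hM,
    BoundedFormula.realize_imp, realize_ordF hM, realize_pairF hM, realize_notF, realize_memF,
    realize_andF]
  have hc (w a α : ZFSet.{u}) : (∃ β ∈ α, CodedBound w a β) ↔
      ∃ β, ∃ _ : β ∈ α, ∃ q, ∃ _ : q ∈ w, q = {a, β} ∧ β ∉ a := by
    simp [CodedBound, and_left_comm]
  simp only [IsBounding, hc]
  exact Iff.rfl

/-- The formula stating that `v₁` is bounding and assigns a bound to `v₀`. -/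
def rankBoundF : LSet.Formula ℕ :=
  andF (boundingF 1) (bexF (.inl 1) (bexF (.inr 0) (andF (ordF (.inr 1))
    (andF (pairF (.inr 0) (.inl 0) (.inr 1)) (notF (memF (.inr 1) (.inl 0)))))))

theorem isDelta0_rankBoundF : IsDelta0 rankBoundF :=
  .andF (isDelta0_boundingF 1) (.bexF _ (.bexF _ (.andF (isDelta0_ordF _)
    (.andF (isDelta0_pairF _ _ _) (.notF (.mem _ _))))))

theorem realize_rankBoundF {M : ZFSet.{u}} (hM : M.IsTransitive) (v : ℕ → M) :
    rankBoundF.Realize v ↔ IsBounding (v 1) ∧ ∃ α, α.IsOrdinal ∧ CodedBound (v 1) (v 0) α := by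
  rw [rankBoundF, Formula.Realize, realize_andF]
  refine and_congr (realize_boundingF hM 1 v) ?_
  simp only [realize_bexF hM, realize_ordF hM, realize_pairF hM, realize_notF, realize_memF,
    realize_andF]
  constructor
  · rintro ⟨p, hp, α, hα, hord, hpair, hn⟩
    change p = {((v 0).1), α} at hpair
    exact ⟨α, hord, hpair ▸ hp, hn⟩
  · rintro ⟨α, hord, hp, hn⟩
    exact ⟨_, hp, α, ZFSet.mem_pair.2 (.inr rfl), hord, rfl, hn⟩

section Transitive

variable {M : ZFSet.{u}}

theorem ModelsKP.pair_mem (hKP : ModelsKP M) (hM : M.IsTransitive) {x y : ZFSet.{u}} (hx : x ∈ M)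
    (hy : y ∈ M) : ({x, y} : ZFSet.{u}) ∈ M := by
  obtain ⟨c, hc⟩ := hKP.pairing ⟨x, hx⟩ ⟨y, hy⟩
  convert c.2 using 1
  ext z
  rw [ZFSet.mem_pair]
  constructor
  · rintro (rfl | rfl)
    exacts [(hc ⟨_, hx⟩).2 (.inl rfl), (hc ⟨_, hy⟩).2 (.inr rfl)]
  · intro hz
    simpa using (hc ⟨z, hM.mem_trans hz c.2⟩).1 hz

theorem ModelsKP.sUnion_mem (hKP : ModelsKP M) (hM : M.IsTransitive) {x : ZFSet.{u}}
    (hx : x ∈ M) : (ZFSet.sUnion x) ∈ M := by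
  obtain ⟨b, hb⟩ := hKP.union ⟨x, hx⟩
  convert b.2 using 1
  ext z
  rw [ZFSet.mem_sUnion]
  constructor
  · rintro ⟨y, hy, hz⟩
    have hyM := hM.mem_trans hy hx
    exact (hb ⟨z, hM.mem_trans hz hyM⟩).2 ⟨⟨y, hyM⟩, hy, hz⟩
  · intro hz
    obtain ⟨y, hy, hzy⟩ := (hb ⟨z, hM.mem_trans hz b.2⟩).1 hz
    exact ⟨y, hy, hzy⟩

theorem ModelsKP.union_mem (hKP : ModelsKP M) (hM : M.IsTransitive) {x y : ZFSet.{u}}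
    (hx : x ∈ M) (hy : y ∈ M) : x ∪ y ∈ M :=
  hKP.sUnion_mem hM (hKP.pair_mem hM hx hy)

theorem ModelsKP.insert_mem (hKP : ModelsKP M) (hM : M.IsTransitive) {x y : ZFSet.{u}}
    (hx : x ∈ M) (hy : y ∈ M) : insert x y ∈ M := by
  rw [ZFSet.insert_eq, ← ZFSet.pair_eq_singleton]
  exact hKP.union_mem hM (hKP.pair_mem hM hx hx) hy

theorem ModelsKP.sep_mem (hKP : ModelsKP M) (hM : M.IsTransitive) {φ : LSet.Formula ℕ}
    (hφ : IsDelta0 φ) {p : ZFSet.{u} → Prop} (hp : ∀ v : ℕ → M, φ.Realize v ↔ p (v 0))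
    {x : ZFSet.{u}} (hx : x ∈ M) : ZFSet.sep p x ∈ M := by
  obtain ⟨b, hb⟩ := hKP.separation φ hφ (fun _ => ⟨x, hx⟩) ⟨x, hx⟩
  simp only [hp, Function.update_self] at hb
  convert b.2 using 1
  ext z
  rw [ZFSet.mem_sep]
  exact ⟨fun hz => (hb ⟨z, hM.mem_trans hz.1 hx⟩).2 hz,
    fun hz => (hb ⟨z, hM.mem_trans hz b.2⟩).1 hz⟩

theorem isOrdinal_sUnion {x : ZFSet.{u}} (h : ∀ y ∈ x, y.IsOrdinal) :
    (ZFSet.sUnion x).IsOrdinal := by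
  rw [ZFSet.isOrdinal_iff_forall_mem_isOrdinal]
  refine ⟨ZFSet.IsTransitive.sUnion' fun y hy => (h y hy).isTransitive, fun y hy => ?_⟩
  obtain ⟨z, hz, hyz⟩ := ZFSet.mem_sUnion.1 hy
  exact (h z hz).mem hyz

/-- One more element can be given a bound, if all its elements have one. -/
theorem IsBounding.insert_pair {w x γ : ZFSet.{u}} (hw : IsBounding w) (hγ : γ.IsOrdinal)
    (h : ∀ y ∈ x, ∃ β ∈ γ, CodedBound w y β) :
    IsBounding (insert {x, γ} w) ∧ CodedBound (insert {x, γ} w) x γ := by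
  have hsub : w ⊆ insert {x, γ} w := fun z hz => ZFSet.mem_insert_of_mem _ hz
  have hxγ : ∀ v ∈ x, ∃ β ∈ γ, CodedBound (insert {x, γ} w) v β := fun v hv => by
    obtain ⟨β, hβ, hc⟩ := h v hv
    exact ⟨β, hβ, hc.mono hsub⟩
  refine ⟨?_, ZFSet.mem_insert _ _, fun hγx => ?_⟩
  · intro p hp u hu α hα hord hpair hn v hv
    rcases ZFSet.mem_insert_iff.1 hp with rfl | hp
    · by_cases hαγ : α = γ
      · subst hαγ
        have hux : u = x := by
          rcases ZFSet.mem_pair.1 hu with rfl | rfl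
          · rfl
          · have : x ∈ ({u, u} : ZFSet.{u}) := hpair ▸ ZFSet.mem_pair.2 (.inl rfl)
            simpa [eq_comm] using this
        exact hxγ v (hux ▸ hv)
      -- The swapped reading: `x` is an ordinal serving as the bound of `γ`. Each `v ∈ x` lies below
      -- some element of `γ`, so `x ⊆ γ`, which contradicts `x ≠ γ` and `x ∉ γ`.
      · have hαx : α = x := (ZFSet.mem_pair.1 hα).resolve_right hαγ
        subst hαx
        have huγ : γ = u := by
          have : γ ∈ ({u, α} : ZFSet.{u}) := hpair ▸ ZFSet.mem_pair.2 (.inr rfl)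
          exact (ZFSet.mem_pair.1 this).resolve_right (Ne.symm hαγ)
        subst huγ
        have hsub : α ⊆ γ := fun v hv => by
          obtain ⟨β, hβ, hc⟩ := h v hv
          have hvβ := ((hγ.mem hβ).notMem_iff_subset (hord.mem hv)).1 hc.2
          exact (hord.mem hv).mem_of_subset_of_mem hγ hvβ hβ
        exact absurd ((hord.subset_iff_eq_or_mem hγ).1 hsub) (by simp [hαγ, hn])
    · obtain ⟨β, hβ, hc⟩ := hw p hp u hu α hα hord hpair hn v hv
      exact ⟨β, hβ, hc.mono hsub⟩
  · obtain ⟨β, hβ, hc⟩ := h γ hγx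
    exact hc.2 hβ

/-- By ∈-induction in the universe: collect witnesses for the elements of `x`, unite them, and
assign to `x` an ordinal above every bound in use. -/
theorem ModelsKP.exists_isBounding (hKP : ModelsKP M) (hM : M.IsTransitive) (x : ZFSet.{u}) :
    x ∈ M → ∃ w ∈ M, IsBounding w ∧ ∃ α, α.IsOrdinal ∧ CodedBound w x α := by
  induction x using ZFSet.inductionOn with
  | _ x ih =>
    intro hx
    obtain ⟨b, hb⟩ := hKP.collection rankBoundF isDelta0_rankBoundF (fun _ => ⟨x, hx⟩) ⟨x, hx⟩
      fun y hy => by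
        obtain ⟨w, hwM, hw⟩ := ih y hy y.2
        refine ⟨⟨w, hwM⟩, (realize_rankBoundF hM _).2 ?_⟩
        simpa using hw
    simp only [realize_rankBoundF hM] at hb
    -- Collection may put unrelated sets into `b`; only the bounding ones may be united.
    let w := ZFSet.sUnion (ZFSet.sep IsBounding b.1)
    have hwM : w ∈ M :=
      hKP.sUnion_mem hM (hKP.sep_mem hM (isDelta0_boundingF 0) (realize_boundingF hM 0) b.2)
    have hw : IsBounding w := .sUnion fun w hw => (ZFSet.mem_sep.1 hw).2
    let o := ZFSet.sep ZFSet.IsOrdinal (ZFSet.sUnion w)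
    have hoM : o ∈ M :=
      hKP.sep_mem hM (isDelta0_ordF (n := 0) (.inl 0)) (fun v => realize_ordF hM _)
        (hKP.sUnion_mem hM hwM)
    let s := ZFSet.sUnion o
    have hsM : s ∈ M := hKP.sUnion_mem hM hoM
    have hs : s.IsOrdinal := isOrdinal_sUnion fun y hy => (ZFSet.mem_sep.1 hy).2
    -- `s` is the supremum of all ordinals occurring in pairs of `w`, so its successor is strictly
    -- above every bound.
    have hγ : (insert s s).IsOrdinal := ZFSet.isOrdinal_succ hs
    have key := hw.insert_pair (x := x) hγ fun y hy => by
      obtain ⟨z, hz, hzb, α, hα, hc⟩ := hb ⟨y, hM.mem_trans hy hx⟩ hy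
      replace hc : CodedBound z y α := hc
      have hzw : z.1 ⊆ w := fun p hp => ZFSet.mem_sUnion_of_mem hp (ZFSet.mem_sep.2 ⟨hz, hzb⟩)
      have hαo : α ∈ o := ZFSet.mem_sep.2 ⟨ZFSet.mem_sUnion_of_mem (by simp) (hzw hc.1), hα⟩
      refine ⟨α, ?_, hc.mono hzw⟩
      rw [ZFSet.mem_insert_iff, ← hα.subset_iff_eq_or_mem hs]
      exact fun p hp => ZFSet.mem_sUnion_of_mem hp hαo
    have hγM := hKP.insert_mem hM hsM hsM
    exact ⟨_, hKP.insert_mem hM (hKP.pair_mem hM hx hγM) hwM, key.1, _, hγ, key.2⟩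

theorem ModelsKP.rank_lt (hKP : ModelsKP M) (hM : M.IsTransitive) {lam : Ordinal.{u}}
    (hlam : lam.toZFSet = ordinalsOf M) {x : ZFSet.{u}} (hx : x ∈ M) : x.rank < lam := by
  obtain ⟨w, hwM, hw, α, hα, hc⟩ := hKP.exists_isBounding hM x hx
  have hαM : α ∈ M := hM.mem_trans (ZFSet.mem_pair.2 (.inr rfl)) (hM.mem_trans hc.1 hwM)
  refine (hw.rank_le hc hα).trans_lt ?_
  rw [← Ordinal.rank_toZFSet lam, hlam]
  exact ZFSet.rank_lt_of_mem (ZFSet.mem_sep.2 ⟨hαM, hα⟩)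

theorem ModelsKP.isSuccLimit (hKP : ModelsKP M) (hM : M.IsTransitive) {lam : Ordinal.{u}}
    (hlam : lam.toZFSet = ordinalsOf M) : Order.IsSuccLimit lam := by
  obtain ⟨a, -⟩ := hKP.empty
  rw [Order.isSuccLimit_iff, Order.isSuccPrelimit_iff_succ_lt]
  refine ⟨not_isMin_of_lt (hKP.rank_lt hM hlam a.2), fun α hα => ?_⟩
  have hαM : α.toZFSet ∈ M := by
    have : α.toZFSet ∈ ordinalsOf M := hlam ▸ Ordinal.toZFSet_mem_toZFSet_iff.2 hα
    exact (ZFSet.mem_sep.1 this).1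
  have := hKP.rank_lt hM hlam (hKP.insert_mem hM hαM hαM)
  rwa [← Ordinal.toZFSet_add_one, Ordinal.rank_toZFSet] at this

end Transitive

/-! ### The constructible hierarchy -/

theorem mem_defPowerset {X s : ZFSet.{u}} : s ∈ defPowerset X ↔
    s ⊆ X ∧ (Set.univ : Set X).Definable₁ LSet {x : X | (x : ZFSet.{u}) ∈ s} := by
  rw [defPowerset, ZFSet.mem_sep, ZFSet.mem_powerset]

theorem sep_mem_defPowerset {X : ZFSet.{u}} (φ : LSet.Formula ℕ) (p : ℕ → X)
    {P : ZFSet.{u} → Prop} (hP : ∀ x : X, φ.Realize (Function.update p 0 x) ↔ P x) :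
    ZFSet.sep P X ∈ defPowerset X := by
  refine mem_defPowerset.2 ⟨ZFSet.sep_subset, Set.definable_iff_exists_formula_sum.2
    -- Variable 0 stays free; every other variable becomes its own value, taken as a parameter.
    ⟨φ.relabel fun i => if i = 0 then .inr 0 else .inl ⟨p i, trivial⟩, ?_⟩⟩
  ext v
  simp only [Set.mem_ofPred_eq, Formula.realize_relabel, ZFSet.mem_sep, SetLike.coe_mem, true_and,
    ← hP]
  refine iff_of_eq (congrArg _ (funext fun i => ?_))
  by_cases hi : i = 0
  · subst hi
    simp
  · simp [hi]

theorem self_mem_defPowerset (X : ZFSet.{u}) : X ∈ defPowerset X := by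
  refine mem_defPowerset.2 ⟨fun _ => id, ?_⟩
  simp [Set.Definable₁]

theorem insert_mem_defPowerset {X s a : ZFSet.{u}} (hs : s ∈ defPowerset X) (ha : a ∈ X) :
    insert a s ∈ defPowerset X := by
  rw [mem_defPowerset] at hs ⊢
  constructor
  · intro z hz
    rcases ZFSet.mem_insert_iff.1 hz with rfl | hz
    exacts [ha, hs.1 hz]
  · have h : (Set.univ : Set X).Definable LSet {v : Fin 1 → X | v 0 = ⟨a, ha⟩} :=
      Set.definable_iff_exists_formula_sum.2
        ⟨Term.equal (.var (.inr 0)) (.var (.inl ⟨⟨a, ha⟩, trivial⟩)), by ext; simp⟩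
    have heq : {v : Fin 1 → X | (v 0 : ZFSet.{u}) ∈ insert a s} =
        {v | v 0 = ⟨a, ha⟩} ∪ {v | (v 0 : ZFSet.{u}) ∈ s} := by
      ext v
      simp [Subtype.ext_iff]
    have := h.union hs.2
    exact (congrArg (Set.univ.Definable LSet) heq).mpr this

theorem subset_defPowerset {X : ZFSet.{u}} (hX : X.IsTransitive) : X ⊆ defPowerset X := by
  intro s hs
  convert sep_mem_defPowerset (memF (.inl 0) (.inl 1)) (fun _ => ⟨s, hs⟩) (P := (· ∈ s))
    (fun x => by rw [Formula.Realize, realize_memF]; simp) using 1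
  ext z
  exact ⟨fun hz => ZFSet.mem_sep.2 ⟨hX.mem_trans hz hs, hz⟩, fun hz => (ZFSet.mem_sep.1 hz).2⟩

theorem isTransitive_constructible (α : Ordinal.{u}) : (constructible α).IsTransitive := by
  induction α using Ordinal.limitRecOn with
  | zero => rw [constructible_zero]; exact ZFSet.isTransitive_empty
  | add_one α ih =>
    rw [constructible_add_one]
    exact fun s hs x hx => subset_defPowerset ih ((mem_defPowerset.1 hs).1 hx)
  | limit α hα ih =>
    rw [constructible_limit hα]
    exact ZFSet.IsTransitive.iUnion fun β => ih β.1 β.2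

theorem constructible_subset {α β : Ordinal.{u}} (h : α ≤ β) :
    constructible α ⊆ constructible β := by
  induction β using Ordinal.limitRecOn with
  | zero => rw [nonpos_iff_eq_zero.1 h]
  | add_one β ih =>
    rcases h.lt_or_eq with h | rfl
    · rw [constructible_add_one]
      exact (ih (Order.lt_add_one_iff.1 h)).trans
        (subset_defPowerset (isTransitive_constructible β))
    · exact fun _ => id
  | limit β hβ ih =>
    rcases h.lt_or_eq with h | rfl
    · rw [constructible_limit hβ]
      exact ZFSet.subset_iUnion (fun γ : Set.Iio β => constructible γ.1) ⟨α, h⟩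
    · exact fun _ => id

theorem constructible_mem {α β : Ordinal.{u}} (h : α < β) :
    constructible α ∈ constructible β := by
  refine constructible_subset (Order.add_one_le_of_lt h) ?_
  rw [constructible_add_one]
  exact self_mem_defPowerset _

theorem mem_constructible_limit {α : Ordinal.{u}} (hα : Order.IsSuccLimit α) {x : ZFSet.{u}} :
    x ∈ constructible α ↔ ∃ β < α, x ∈ constructible β := by
  simp [constructible_limit hα]

theorem insert_mem_constructible {α : Ordinal.{u}} (hα : Order.IsSuccLimit α) {x y : ZFSet.{u}}
    (hx : x ∈ constructible α) (hy : y ∈ constructible α) : insert x y ∈ constructible α := by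
  rw [mem_constructible_limit hα] at hx hy ⊢
  obtain ⟨β, hβ, hx⟩ := hx
  obtain ⟨γ, hγ, hy⟩ := hy
  refine ⟨max β γ + 1, hα.add_one_lt (max_lt hβ hγ), ?_⟩
  rw [constructible_add_one]
  refine insert_mem_defPowerset (subset_defPowerset (isTransitive_constructible _) ?_)
    (constructible_subset (le_max_left _ _) hx)
  exact constructible_subset (le_max_right _ _) hy

theorem empty_mem_constructible {α : Ordinal.{u}} (hα : 0 < α) : ∅ ∈ constructible α := by
  have := constructible_mem hα
  rwa [constructible_zero] at this

/-- The range of a function on a finite type is a hereditarily finite set if its values are. -/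
theorem range_mem_constructible {α : Ordinal.{u}} (hα : Order.IsSuccLimit α) {ι : Type}
    [Finite ι] {f : ι → ZFSet.{u}} (hf : ∀ i, f i ∈ constructible α) :
    ZFSet.range f ∈ constructible α := by
  have key (s : Set ι) (hs : s.Finite) : ZFSet.range (fun i : s => f i) ∈ constructible α := by
    induction s, hs using Set.Finite.induction_on with
    | empty =>
      convert empty_mem_constructible hα.bot_lt
      ext
      simp
    | @insert a s _ _ ih =>
      convert insert_mem_constructible hα (hf a) ih
      ext
      simp [eq_comm]
  convert key _ Set.finite_univ
  ext
  simp

/-! ### Hereditarily finite markers -/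

/-- Hereditarily finite sets such that, for `i < n`, `marker R i ∈ marker R n` if and only if
`R n i`. -/
noncomputable def marker (R : ℕ → ℕ → Prop) (n : ℕ) : ZFSet.{u} :=
  insert (ZFSet.range fun i : Fin n => marker R i)
    (ZFSet.range fun i : {i : Fin n // R n i} => marker R i.1)
termination_by n
decreasing_by
  · exact i.2
  · exact i.1.2

/-- The set of those `marker R i` with `i < n` and `R i n`. -/
noncomputable def lowerMarkers (R : ℕ → ℕ → Prop) (n : ℕ) : ZFSet.{u} :=
  ZFSet.range fun i : {i : Fin n // R i n} => marker R i.1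

section Marker

variable {R : ℕ → ℕ → Prop}

theorem rank_marker_lt {i n : ℕ} (h : i < n) :
    (marker.{u} R i).rank < (ZFSet.range fun i : Fin n => marker.{u} R i).rank :=
  ZFSet.rank_lt_of_mem (ZFSet.mem_range.2 ⟨(⟨i, h⟩ : Fin n), rfl⟩)

theorem rank_range_lt_marker (n : ℕ) :
    (ZFSet.range fun i : Fin n => marker.{u} R i).rank < (marker.{u} R n).rank := by
  conv_rhs => rw [marker]
  exact ZFSet.rank_lt_of_mem (ZFSet.mem_insert _ _)

/-- This is the purpose of the extra element of `marker R n`, the set of all earlier markers: it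
forces the ranks up, so markers are distinct and membership between them respects the order of
indices. -/
theorem strictMono_rank_marker : StrictMono fun n => (marker.{u} R n).rank :=
  fun _ n h => (rank_marker_lt h).trans (rank_range_lt_marker n)

theorem marker_injective : Function.Injective (marker.{u} R) := fun _ _ h =>
  strictMono_rank_marker.injective (congrArg ZFSet.rank h)

theorem marker_mem_marker {i n : ℕ} : marker.{u} R i ∈ marker.{u} R n ↔ i < n ∧ R n i := by
  constructor
  · intro h
    have hi : i < n := strictMono_rank_marker.lt_iff_lt.1 (ZFSet.rank_lt_of_mem h)
    rw [marker.eq_def R n, ZFSet.mem_insert_iff, ZFSet.mem_range] at h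
    rcases h with h | ⟨j, hj⟩
    -- The extra element has too large a rank to be an earlier marker.
    · exact absurd (rank_marker_lt hi) (by rw [← h]; exact lt_irrefl _)
    · have := marker_injective hj
      exact ⟨hi, this ▸ j.2⟩
  · rintro ⟨hi, hR⟩
    rw [marker.eq_def R n, ZFSet.mem_insert_iff, ZFSet.mem_range]
    exact .inr ⟨⟨⟨i, hi⟩, hR⟩, rfl⟩

theorem marker_mem_lowerMarkers {i n : ℕ} :
    marker.{u} R i ∈ lowerMarkers.{u} R n ↔ i < n ∧ R i n := by
  rw [lowerMarkers, ZFSet.mem_range]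
  constructor
  · rintro ⟨j, hj⟩
    have := marker_injective hj
    exact ⟨this ▸ j.1.2, this ▸ j.2⟩
  · rintro ⟨hi, hR⟩
    exact ⟨⟨⟨i, hi⟩, hR⟩, rfl⟩

theorem marker_mem_constructible {α : Ordinal.{u}} (hα : Order.IsSuccLimit α) (n : ℕ) :
    marker R n ∈ constructible α := by
  induction n using Nat.strong_induction_on with
  | _ n ih =>
    rw [marker]
    exact insert_mem_constructible hα (range_mem_constructible hα fun i => ih i i.2)
      (range_mem_constructible hα fun i => ih i.1 i.1.2)

theorem lowerMarkers_mem_constructible {α : Ordinal.{u}} (hα : Order.IsSuccLimit α) (n : ℕ) :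
    lowerMarkers R n ∈ constructible α :=
  range_mem_constructible hα fun i => marker_mem_constructible hα i.1

end Marker

/-! ### Embedding a countable well-founded relation into the constructible hierarchy -/

/-- The elements of `L_α` which have an element `m ∈ h` with `m ∈ a` or `d ∈ m`, and the
elements `d` and `h`. -/
noncomputable def markedSet (α : Ordinal.{u}) (h d a : ZFSet.{u}) : ZFSet.{u} :=
  ZFSet.sep (fun z => z = d ∨ z = h ∨ h ∈ z ∧ ∃ m ∈ z, m ∈ h ∧ (m ∈ a ∨ d ∈ m)) (constructible α)

theorem markedSet_mem_constructible {α : Ordinal.{u}} {h d a : ZFSet.{u}}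
    (hh : h ∈ constructible α) (hd : d ∈ constructible α) (ha : a ∈ constructible α) :
    markedSet α h d a ∈ constructible (α + 1) := by
  rw [constructible_add_one]
  let p : ℕ → constructible α := fun i => if i = 1 then ⟨d, hd⟩ else if i = 2 then ⟨h, hh⟩ else
    ⟨a, ha⟩
  refine sep_mem_defPowerset (orF (eqF (.inl 0) (.inl 1)) (orF (eqF (.inl 0) (.inl 2))
    (andF (memF (.inl 2) (.inl 0)) (bexF (.inl 0) (andF (memF (.inr 0) (.inl 2))
      (orF (memF (.inr 0) (.inl 3)) (memF (.inl 1) (.inr 0)))))))) p fun x => ?_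
  simp only [Formula.Realize, realize_orF, realize_andF, realize_eqF, realize_memF,
    realize_bexF (isTransitive_constructible α), ← exists_prop]
  exact Iff.rfl

theorem exists_embedding_constructible {M : ZFSet.{u}}
    (hcount : (M : Set ZFSet.{u}).Countable) {lam : Ordinal.{u}} (hlam : Order.IsSuccLimit lam)
    (hrank : ∀ x ∈ M, x.rank < lam) {μ : Ordinal.{u}} (hμ : Ordinal.omega0 + lam ≤ μ) :
    Nonempty (M ↪[LSet] constructible μ) := by
  obtain ⟨e, he⟩ := hcount.to_subtype.exists_injective_nat
  let R : ℕ → ℕ → Prop := fun i j => ∃ x y : M, e x = i ∧ e y = j ∧ x.1 ∈ y.1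
  have hR (x y : M) : R (e x) (e y) ↔ x.1 ∈ y.1 :=
    ⟨fun ⟨x', y', hx, hy, h⟩ => he hx ▸ he hy ▸ h, fun h => ⟨x, y, rfl, rfl, h⟩⟩
  let h := constructible.{u} Ordinal.omega0
  have hω : Order.IsSuccLimit Ordinal.omega0.{u} := Ordinal.isSuccLimit_omega0
  -- The final `+ 1` puts `L_ω` itself into `L_{β x}`, even for rank 0. If `x ∈ y` then `β x + 1 ≤ β
  -- y`, so `f x` is available when `f y` is formed.
  let β (x : M) : Ordinal.{u} := Ordinal.omega0 + x.1.rank + 1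
  have hωβ (x : M) : Ordinal.omega0 < β x := Order.lt_add_one_iff.2 le_self_add
  let f (x : M) : ZFSet.{u} := markedSet (β x) h (marker R (e x)) (lowerMarkers R (e x))
  have hmh (n : ℕ) : marker R n ∈ h := marker_mem_constructible hω n
  have hfβ (x : M) : f x ∈ constructible (β x + 1) :=
    markedSet_mem_constructible (constructible_mem (hωβ x))
      (constructible_subset (hωβ x).le (hmh _))
      (constructible_subset (hωβ x).le (lowerMarkers_mem_constructible hω _))
  have hf (x : M) : f x ∈ constructible μ := by
    refine constructible_subset (le_trans ?_ hμ) (hfβ x)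
    have : x.1.rank + 1 + 1 < lam := hlam.add_one_lt (hlam.add_one_lt (hrank x x.2))
    simpa [β, add_assoc] using (add_le_add_right this.le Ordinal.omega0)
  have hhf (x : M) : h ∈ f x := ZFSet.mem_sep.2 ⟨constructible_mem (hωβ x), .inr (.inl rfl)⟩
  have hne (x : M) : f x ∉ h := fun hx =>
    ZFSet.mem_asymm hx (hhf x)
  -- Elements of `f x` of the third kind contain `h`, hence lie outside `h`; only the marker
  -- remains.
  have hmf (x : M) (m : ZFSet.{u}) : m ∈ f x ∧ m ∈ h ↔ m = marker R (e x) := by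
    constructor
    · rintro ⟨hm, hmh'⟩
      rcases (ZFSet.mem_sep.1 hm).2 with hm | rfl | ⟨hm, -⟩
      · exact hm
      · exact absurd hmh' (ZFSet.mem_irrefl _)
      · exact absurd hm (ZFSet.mem_asymm hmh')
    · rintro rfl
      exact ⟨ZFSet.mem_sep.2 ⟨constructible_subset (hωβ x).le (hmh _), .inl rfl⟩, hmh _⟩
  have hinj : Function.Injective f := fun x y hxy =>
    he (marker_injective ((hmf y _).1 (hxy ▸ (hmf x _).2 rfl)))
  have hmem (x y : M) : f x ∈ f y ↔ x.1 ∈ y.1 := by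
    -- The only candidate for `m` is the marker of `x`. The first alternative settles `e x < e y`,
    -- the second `e y < e x`.
    have hiff : (∃ m ∈ f x, m ∈ h ∧ (m ∈ lowerMarkers R (e y) ∨ marker R (e y) ∈ m)) ↔
        x.1 ∈ y.1 := by
      simp only [← and_assoc, hmf, exists_eq_left, marker_mem_lowerMarkers, marker_mem_marker, hR]
      refine ⟨fun h => h.elim And.right And.right, fun hxy => ?_⟩
      rcases lt_trichotomy (e x) (e y) with hlt | heq | hlt
      · exact .inl ⟨hlt, hxy⟩
      · exact absurd hxy (he heq ▸ ZFSet.mem_irrefl _)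
      · exact .inr ⟨hlt, hxy⟩
    constructor
    · intro hxy
      rcases (ZFSet.mem_sep.1 hxy).2 with hm | hm | ⟨-, hm⟩
      · exact absurd (hm ▸ hmh _) (hne x)
      · exact absurd (hhf x) (by rw [hm]; exact ZFSet.mem_irrefl _)
      · exact hiff.1 hm
    · intro hxy
      refine ZFSet.mem_sep.2 ⟨constructible_subset ?_ (hfβ x), .inr (.inr ⟨hhf x, hiff.2 hxy⟩)⟩
      have : x.1.rank + 1 ≤ y.1.rank := Order.add_one_le_of_lt (ZFSet.rank_lt_of_mem hxy)
      exact add_le_add_left ((add_assoc _ _ _).trans_le (add_le_add_right this _)) 1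
  exact ⟨{
    toFun := fun x => ⟨f x, hf x⟩
    inj' := fun x y hxy => hinj (congrArg Subtype.val hxy)
    map_fun' := fun g => Empty.elim g
    map_rel' := fun {_} r v => by
      cases r
      exact hmem (v 0) (v 1) }⟩

end KPSet

theorem mainTheorem12 (M : ZFSet.{u}) (hM : M.IsTransitive)
    (hcount : (M : Set ZFSet.{u}).Countable) (hKP : KPSet.ModelsKP M)
    (lam : Ordinal.{u}) (hlam : lam.toZFSet = KPSet.ordinalsOf M) :
    ∃ N : KPSet.LSet.Substructure (KPSet.constructible (lam + lam)),
      Nonempty (FirstOrder.Language.Equiv KPSet.LSet M N) := by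
  have hlim := hKP.isSuccLimit hM hlam
  obtain ⟨f⟩ := KPSet.exists_embedding_constructible hcount hlim
    (fun x hx => hKP.rank_lt hM hlam hx)
    (add_le_add_left (Ordinal.omega0_le_of_isSuccLimit hlim) lam)
  exact ⟨_, ⟨f.equivRange⟩⟩
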